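/- All graphs are finite and simple. A matching of a graph $G$ is a set of edges of $G$ no two of which share a vertex; it is maximal if it is not properly contained in another matching of $G$. Let $\Psi(G)$ be the number of maximal matchings of $G$. For integers $0\le t\le m$ let $S^{t}(K_{1,m})$ be the tree with $2m-t+1$ vertices obtained from the star $K_{1,m}$ (with centre and $m$ leaves; $K_{1,0}$ is a single vertex) by subdividing $m-t$ of its $m$ edges, each by one new vertex; so exactly $t$ edges are left unsubdivided. Theorem. For every tree $T$ with $n\ge 1$ vertices, $\Psi(T)\ge\lceil n/2\rceil$. Moreover, equality holds if and only if - $n$ is odd and $T$ is isomorphic to $S^{0}(K_{1,\frac{n-1}{2}})$ or (when $n\ge 3$) to $S^{2}(K_{1,\frac{n+1}{2}})$; or - $n$ is even and $T$ is isomorphic to $S^{1}(K_{1,\frac{n}{2}})$. -/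

import Mathlib

/-- The number `Ψ(G)` of maximal matchings of `G`. A Mathlib matching is a subgraph whose vertices
all have exactly one neighbour in it; it has no isolated vertices, so it is determined by its edge
set, and the order of subgraphs restricts on matchings to the inclusion of edge sets. -/
noncomputable def numMaximalMatchings {V : Type*} (G : SimpleGraph V) : ℕ :=
  {M : G.Subgraph | Maximal SimpleGraph.Subgraph.IsMatching M}.ncard

/-- The graph obtained from `G` by subdividing once each edge in the set `F` of edges of `G`:
the new vertex `Sum.inr e` is placed in the middle of the edge `e ∈ F`. -/
def subdivideEdges {V : Type*} (G : SimpleGraph V) (F : Set G.edgeSet) :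
    SimpleGraph (V ⊕ F) where
  Adj
    | Sum.inl u, Sum.inl v => ∃ e : G.edgeSet, e ∉ F ∧ (e : Sym2 V) = s(u, v)
    | Sum.inl u, Sum.inr e => u ∈ (e.1 : Sym2 V)
    | Sum.inr e, Sum.inl u => u ∈ (e.1 : Sym2 V)
    | Sum.inr _, Sum.inr _ => False
  symm := ⟨by
    rintro (u | e) (v | f) h
    · obtain ⟨e, he, h⟩ := h
      exact ⟨e, he, h.trans Sym2.eq_swap⟩
    · exact h
    · exact h
    · exact h⟩
  loopless := ⟨by
    rintro (u | e) h
    · obtain ⟨⟨e, he⟩, -, h⟩ := h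
      have h' : e = s(u, u) := h
      subst h'
      exact G.loopless.irrefl u he
    · exact h⟩

/-- The star `K_{1,m}`, with centre `Sum.inl 0` and leaves `Sum.inr i`. -/
abbrev starKOne (m : ℕ) : SimpleGraph (Fin 1 ⊕ Fin m) :=
  completeBipartiteGraph (Fin 1) (Fin m)

/-- The edges of `K_{1,m}` other than the first `t` ones; there are `m - t` of them if `t ≤ m`. -/
def starEdgesFrom (t m : ℕ) : Set (starKOne m).edgeSet :=
  {e | ∃ i : Fin m, t ≤ (i : ℕ) ∧ (e : Sym2 (Fin 1 ⊕ Fin m)) = s(Sum.inl 0, Sum.inr i)}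

/-- The starlike tree `S^t(K_{1,m})`, `t ≤ m`: the star `K_{1,m}` with `m - t` of its edges
subdivided and `t` of its edges left as they are. -/
abbrev subdividedStar (t m : ℕ) : SimpleGraph ((Fin 1 ⊕ Fin m) ⊕ starEdgesFrom t m) :=
  subdivideEdges (starKOne m) (starEdgesFrom t m)

/-!
Write `Ψ` for the number of maximal matchings.

The lower bound is proved by induction on the number `n` of vertices. A degree count shows that a
tree with at least three vertices has two leaves `x`, `y` with a common neighbour `s`, or a leaf `x`
whose neighbour `s` has degree two, with a further neighbour `w`
(`SimpleGraph.IsTree.exists_twin_leaves_or_pendant_path`). In the first case the maximal matchings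
of `T - x` extend to maximal matchings of `T` without the edge `sx`, in the second case those of
`T - x - s` extend by the edge `sx`, hence without the edge `ws`. A maximal matching through `sx`,
or through `ws`, comes in addition, so at most two vertices are removed and `Ψ` drops by at least
one.

If equality holds, then only one maximal matching contains the edge in question, so that deleting
both ends of that edge leaves no path with three vertices. It follows that `T - c` has maximum degree at most one
for `c = s` or `c = w`: the tree is *starlike* at `c`
(`SimpleGraph.IsTree.half_le_numMaximalMatchings_and`), and such a tree is a subdivided star
`S^t(K_{1,m})` with `m = deg c` and `n = 2 * m - t + 1`
(`SimpleGraph.IsTree.exists_iso_subdividedStar`). As edges at `c` lie in different maximal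
matchings, `m ≤ Ψ(T)`, and `Ψ(T) = ⌈n / 2⌉` leaves only `t ≤ 2`.

Conversely, a maximal matching of a subdivided star is determined by the partner of the centre, and
the centre has a partner if one of its neighbours is a leaf. So `Ψ` is at most `m + 1` for `t = 0`
and at most `m` for `t > 0`, which is the lower bound for `t = 0, 1, 2`.
-/

namespace SimpleGraph

variable {V W : Type*} {G : SimpleGraph V} {H : SimpleGraph W}

/-! ### Maximal matchings -/

/-- A matching is maximal iff its vertices form a vertex cover. -/
theorem maximal_isMatching_iff {M : G.Subgraph} :
    Maximal Subgraph.IsMatching M ↔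
      M.IsMatching ∧ ∀ u v, G.Adj u v → u ∈ M.verts ∨ v ∈ M.verts := by
  constructor
  · refine fun hM => ⟨hM.prop, fun u v huv => ?_⟩
    by_contra! h
    have hmatch : (M ⊔ G.subgraphOfAdj huv).IsMatching := by
      refine hM.prop.sup (Subgraph.IsMatching.subgraphOfAdj huv) ?_
      rw [hM.prop.support_eq_verts, support_subgraphOfAdj, Set.disjoint_right]
      rintro a (rfl | rfl)
      exacts [h.1, h.2]
    have hle := hM.le_of_ge hmatch le_sup_left
    exact h.1 (hle.1 (by simp))
  · rintro ⟨hM, hcov⟩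
    refine ⟨hM, fun N hN hle => ?_⟩
    have hverts : N.verts ⊆ M.verts := by
      intro a ha
      obtain ⟨b, hab, -⟩ := hN ha
      rcases hcov a b (N.adj_sub hab) with h | h
      · exact h
      · obtain ⟨c, hbc, -⟩ := hM h
        obtain rfl := hN.eq_of_adj_left hab.symm (hle.2 hbc)
        exact M.edge_vert hbc.symm
    refine ⟨hverts, fun a b hab => ?_⟩
    obtain ⟨c, hac, -⟩ := hM (hverts (N.edge_vert hab))
    rwa [hN.eq_of_adj_left hab (hle.2 hac)]

theorem Subgraph.IsMatching.ext_adj {M N : G.Subgraph} (hM : M.IsMatching) (hN : N.IsMatching)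
    (h : ∀ u v, M.Adj u v ↔ N.Adj u v) : M = N := by
  refine Subgraph.ext ?_ (by ext u v; exact h u v)
  rw [← hM.support_eq_verts, ← hN.support_eq_verts]
  ext v
  simp [Subgraph.mem_support, h]

theorem exists_maximal_isMatching_adj [Finite V] {a b : V} (hab : G.Adj a b) :
    ∃ M : G.Subgraph, Maximal Subgraph.IsMatching M ∧ M.Adj a b := by
  obtain ⟨M, hle, hM⟩ := Finite.exists_le_maximal (Subgraph.IsMatching.subgraphOfAdj hab)
  exact ⟨M, hM, hle.2 (by simp)⟩

theorem numMaximalMatchings_pos [Finite V] (G : SimpleGraph V) : 0 < numMaximalMatchings G := by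
  have hbot : (⊥ : G.Subgraph).IsMatching := by
    intro v hv
    simp at hv
  obtain ⟨M, -, hM⟩ := Finite.exists_le_maximal hbot
  exact (Set.ncard_pos (Set.toFinite _)).2 ⟨M, hM⟩

/-- Every vertex `v` satisfies `deg v ≤ Ψ(G)`: the edges at `v` lie in different matchings. -/
theorem ncard_neighborSet_le_numMaximalMatchings [Finite V] (G : SimpleGraph V) (v : V) :
    (G.neighborSet v).ncard ≤ numMaximalMatchings G := by
  choose! f hf hadj using fun w (hw : w ∈ G.neighborSet v) => exists_maximal_isMatching_adj hw
  refine Set.ncard_le_ncard_of_injOn f hf ?_ (Set.toFinite _)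
  intro a ha b hb hab
  have hb' := hadj b hb
  rw [← hab] at hb'
  exact (hf a ha).prop.eq_of_adj_left (hadj a ha) hb'

/-- Let `H` be an induced subgraph of `G`. A maximal matching of `H` extends to one of `G`, and it
is recovered from the extension by restriction to `H`. So if the extensions can be chosen to avoid
a property `P`, the maximal matchings of `G` with the property `P` come in addition. -/
theorem numMaximalMatchings_add_ncard_le [Finite V] (φ : H ↪g G) (P : G.Subgraph → Prop)
    (h : ∀ M : H.Subgraph, Maximal Subgraph.IsMatching M → ∃ N : G.Subgraph, N.IsMatching ∧
      M.map φ.toHom ≤ N ∧ ∀ N' : G.Subgraph, N'.IsMatching → N ≤ N' → ¬ P N') :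
    numMaximalMatchings H + {M : G.Subgraph | Maximal Subgraph.IsMatching M ∧ P M}.ncard ≤
      numMaximalMatchings G := by
  have hext : ∀ M : H.Subgraph, Maximal Subgraph.IsMatching M → ∃ N : G.Subgraph,
      (Maximal Subgraph.IsMatching N ∧ ¬ P N) ∧ M.map φ.toHom ≤ N := by
    intro M hM
    obtain ⟨N, hN, hle, hP⟩ := h M hM
    obtain ⟨N', hle', hN'⟩ := Finite.exists_le_maximal hN
    exact ⟨N', ⟨hN', hP N' hN'.prop hle'⟩, hle.trans hle'⟩
  choose! f hf hfle using hext
  have hadj : ∀ M : H.Subgraph, Maximal Subgraph.IsMatching M → ∀ u v,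
      (f M).Adj (φ u) (φ v) ↔ M.Adj u v := by
    have hsub : ∀ M : H.Subgraph, Maximal Subgraph.IsMatching M → ∀ u v,
        M.Adj u v → (f M).Adj (φ u) (φ v) := fun M hM u v huv =>
      (hfle M hM).2 ⟨u, v, huv, rfl, rfl⟩
    have key : ∀ M : H.Subgraph, Maximal Subgraph.IsMatching M → ∀ u v,
        u ∈ M.verts → (f M).Adj (φ u) (φ v) → M.Adj u v := by
      intro M hM u v hu huv
      obtain ⟨w, hw, -⟩ := hM.prop hu
      rwa [φ.injective ((hf M hM).1.prop.eq_of_adj_left huv (hsub M hM u w hw))]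
    refine fun M hM u v => ⟨fun huv => ?_, hsub M hM u v⟩
    have hH : H.Adj u v := φ.map_adj_iff.1 ((f M).adj_sub huv)
    rcases (maximal_isMatching_iff.1 hM).2 u v hH with hu | hv
    · exact key M hM u v hu huv
    · exact (key M hM v u hv huv.symm).symm
  have hle : numMaximalMatchings H ≤
      {M : G.Subgraph | Maximal Subgraph.IsMatching M ∧ ¬ P M}.ncard := by
    refine Set.ncard_le_ncard_of_injOn f hf ?_ (Set.toFinite _)
    intro M hM N hN hMN
    refine hM.prop.ext_adj hN.prop fun u v => ?_
    rw [← hadj M hM, ← hadj N hN, hMN]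
  calc _ ≤ {M : G.Subgraph | Maximal Subgraph.IsMatching M ∧ ¬ P M}.ncard +
        {M : G.Subgraph | Maximal Subgraph.IsMatching M ∧ P M}.ncard :=
        Nat.add_le_add_right hle _
    _ = ({M : G.Subgraph | Maximal Subgraph.IsMatching M ∧ ¬ P M} ∪
        {M : G.Subgraph | Maximal Subgraph.IsMatching M ∧ P M}).ncard := by
        refine (Set.ncard_union_eq ?_ (Set.toFinite _) (Set.toFinite _)).symm
        exact Set.disjoint_left.2 fun M h1 h2 => h1.2 h2.2
    _ ≤ _ := Set.ncard_le_ncard (by rintro M (h | h) <;> exact h.1) (Set.toFinite _)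

theorem Embedding.numMaximalMatchings_le [Finite V] (φ : H ↪g G) :
    numMaximalMatchings H ≤ numMaximalMatchings G := by
  refine le_trans (Nat.le_add_right _ _) (numMaximalMatchings_add_ncard_le φ (fun _ => False) ?_)
  exact fun M hM => ⟨M.map φ.toHom, hM.prop.map _ φ.injective, le_rfl, fun _ _ _ h => h⟩

theorem Iso.numMaximalMatchings_eq [Finite V] (e : H ≃g G) :
    numMaximalMatchings H = numMaximalMatchings G := by
  have : Finite W := Finite.of_equiv V e.symm.toEquiv
  exact le_antisymm e.toEmbedding.numMaximalMatchings_le e.symm.toEmbedding.numMaximalMatchings_le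

/-! ### Maximal matchings through a given edge -/

theorem one_le_ncard_maximal_isMatching_adj [Finite V] {a b : V} (hab : G.Adj a b) :
    1 ≤ {M : G.Subgraph | Maximal Subgraph.IsMatching M ∧ M.Adj a b}.ncard := by
  obtain ⟨M, hM⟩ := exists_maximal_isMatching_adj hab
  exact (Set.ncard_pos (Set.toFinite _)).2 ⟨M, hM⟩

/-- If `G - a - b` contains a path `p - q - r`, then the edge `ab` lies in two maximal matchings:
one contains `qp` and the other `qr`. -/
theorem two_le_ncard_maximal_isMatching_adj [Finite V] {a b p q r : V} (hab : G.Adj a b)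
    (hqp : G.Adj q p) (hqr : G.Adj q r) (hpr : p ≠ r) (hqa : q ≠ a) (hqb : q ≠ b)
    (hpa : p ≠ a) (hpb : p ≠ b) (hra : r ≠ a) (hrb : r ≠ b) :
    2 ≤ {M : G.Subgraph | Maximal Subgraph.IsMatching M ∧ M.Adj a b}.ncard := by
  have hext : ∀ c, G.Adj q c → c ≠ a → c ≠ b →
      ∃ M : G.Subgraph, (Maximal Subgraph.IsMatching M ∧ M.Adj a b) ∧ M.Adj q c := by
    intro c hqc hca hcb
    have hmatch : (G.subgraphOfAdj hab ⊔ G.subgraphOfAdj hqc).IsMatching := by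
      refine (Subgraph.IsMatching.subgraphOfAdj hab).sup (Subgraph.IsMatching.subgraphOfAdj hqc) ?_
      simp only [support_subgraphOfAdj, Set.disjoint_left]
      rintro x (rfl | rfl) (h | h) <;> simp_all
    obtain ⟨M, hle, hM⟩ := Finite.exists_le_maximal hmatch
    exact ⟨M, ⟨hM, hle.2 (by simp)⟩, hle.2 (by simp)⟩
  obtain ⟨M, hM, hMp⟩ := hext p hqp hpa hpb
  obtain ⟨N, hN, hNr⟩ := hext r hqr hra hrb
  refine (Set.one_lt_ncard_iff (Set.toFinite _)).2 ⟨M, N, hM, hN, ?_⟩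
  rintro rfl
  exact hpr (hM.1.prop.eq_of_adj_left hMp hNr)

/-- The graph `G - c` has maximum degree at most one. For a tree `G` this says that `G` consists of
legs of length one and two at the centre `c`. -/
def IsStarlikeAt (G : SimpleGraph V) (c : V) : Prop :=
  ∀ a b₁ b₂, a ≠ c → b₁ ≠ c → b₂ ≠ c → G.Adj a b₁ → G.Adj a b₂ → b₁ = b₂

/-- Removal of one of two leaves `x`, `y` with a common neighbour `s`: the maximal matchings of the
remaining graph cover `s`, since they cover `s` or `y`; so they extend without the edge `sx`. -/
theorem numMaximalMatchings_add_ncard_le_of_twin_leaves [Finite V] {x y s : V} (φ : H ↪g G)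
    (hφ : Set.range φ = {x}ᶜ) (hxy : y ≠ x) (hys : G.Adj y s) (hxs : G.Adj x s)
    (hy : ∀ z, G.Adj y z → z = s) :
    numMaximalMatchings H + {M : G.Subgraph | Maximal Subgraph.IsMatching M ∧ M.Adj s x}.ncard ≤
      numMaximalMatchings G := by
  refine numMaximalMatchings_add_ncard_le φ _ fun M hM =>
    ⟨M.map φ.toHom, hM.prop.map _ φ.injective, le_rfl, fun N' hN' hle hsx => ?_⟩
  obtain ⟨y', rfl⟩ : y ∈ Set.range φ := by rw [hφ]; exact hxy
  obtain ⟨s', rfl⟩ : s ∈ Set.range φ := by rw [hφ]; exact hxs.ne'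
  have hs : s' ∈ M.verts := by
    rcases (maximal_isMatching_iff.1 hM).2 y' s' (φ.map_adj_iff.1 hys) with h | h
    · obtain ⟨z, hz, -⟩ := hM.prop h
      have := φ.injective (hy (φ z) (φ.map_adj_iff.2 (M.adj_sub hz)))
      exact this ▸ M.edge_vert hz.symm
    · exact h
  obtain ⟨z, hz, -⟩ := hM.prop hs
  have hz' : N'.Adj (φ s') (φ z) := hle.2 ⟨s', z, hz, rfl, rfl⟩
  have : φ z ∈ ({x}ᶜ : Set V) := hφ ▸ Set.mem_range_self z
  exact this (hN'.eq_of_adj_left hz' hsx)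

/-- Removal of the ends of an edge `sx`: the maximal matchings of the remaining graph extend by
`sx`, hence without any other edge `ws`. -/
theorem numMaximalMatchings_add_ncard_le_of_edge [Finite V] {x s w : V} (φ : H ↪g G)
    (hφ : Set.range φ = {x, s}ᶜ) (hsx : G.Adj s x) (hwx : w ≠ x) :
    numMaximalMatchings H + {M : G.Subgraph | Maximal Subgraph.IsMatching M ∧ M.Adj w s}.ncard ≤
      numMaximalMatchings G := by
  refine numMaximalMatchings_add_ncard_le φ _ fun M hM =>
    ⟨M.map φ.toHom ⊔ G.subgraphOfAdj hsx, ?_, le_sup_left, fun N' hN' hle hws => ?_⟩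
  · refine (hM.prop.map _ φ.injective).sup (Subgraph.IsMatching.subgraphOfAdj hsx) ?_
    rw [(hM.prop.map φ.toHom φ.injective).support_eq_verts, support_subgraphOfAdj,
      Set.disjoint_left]
    rintro _ ⟨z, -, rfl⟩ hz
    have hmem : φ z ∈ ({x, s}ᶜ : Set V) := hφ ▸ Set.mem_range_self z
    exact hmem (by rw [Set.pair_comm]; exact hz)
  · have h : N'.Adj s x := hle.2 (by simp)
    exact hwx (hN'.eq_of_adj_left hws.symm h)

/-! ### Leaves of trees -/

theorem IsTree.induce_compl_leaf [Finite V] {T : SimpleGraph V} (hT : T.IsTree) {x s : V}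
    (hxs : T.Adj x s) (hx : ∀ z, T.Adj x z → z = s) : (T.induce {x}ᶜ).IsTree := by
  classical
  cases nonempty_fintype V
  refine ⟨hT.connected.induce_compl_singleton_of_degree_eq_one ?_, hT.isAcyclic.induce _⟩
  rw [← card_neighborFinset_eq_degree, Finset.card_eq_one]
  refine ⟨s, ?_⟩
  ext z
  simp only [mem_neighborFinset, Finset.mem_singleton]
  exact ⟨hx z, fun h => h ▸ hxs⟩

/-- In a tree with at least three vertices, two leaves have a common neighbour or a leaf `x` has a
neighbour `s` of degree two. Otherwise the neighbours of the leaves would be different vertices of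
degree at least three, and the average degree would be at least two. -/
theorem IsTree.exists_twin_leaves_or_pendant_path [Fintype V] {T : SimpleGraph V} (hT : T.IsTree)
    (hcard : 3 ≤ Fintype.card V) :
    ∃ x s, T.Adj x s ∧ (∀ z, T.Adj x z → z = s) ∧
      ((∃ y, y ≠ x ∧ T.Adj y s ∧ ∀ z, T.Adj y z → z = s) ∨
        ∃ w, w ≠ x ∧ T.Adj s w ∧ ∀ z, T.Adj s z → z = x ∨ z = w) := by
  classical
  by_contra! hcon
  have : Nontrivial V := Fintype.one_lt_card_iff_nontrivial.1 (by omega)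
  have hpos : ∀ v, 0 < T.degree v := fun v => hT.connected.preconnected.degree_pos_of_nontrivial v
  have hleaf : ∀ x ∈ Finset.univ.filter (fun v => T.degree v = 1),
      ∃ s, T.Adj x s ∧ ∀ z, T.Adj x z → z = s := by
    intro x hx
    simp only [Finset.mem_filter, Finset.mem_univ, true_and] at hx
    obtain ⟨s, hs⟩ := Finset.card_eq_one.1 (T.card_neighborFinset_eq_degree x ▸ hx)
    simp only [Finset.ext_iff, mem_neighborFinset, Finset.mem_singleton] at hs
    exact ⟨s, (hs s).2 rfl, fun z => (hs z).1⟩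
  choose! f hadj huniq using hleaf
  have hle : (Finset.univ.filter (fun v => T.degree v = 1)).card ≤
      (Finset.univ.filter (fun v => 3 ≤ T.degree v)).card := by
    refine Finset.card_le_card_of_injOn f (fun x hx => ?_) (fun x hx y hy hxy => ?_)
    · obtain ⟨-, h2⟩ := hcon x (f x) (hadj x hx) (huniq x hx)
      have hT' := hT.induce_compl_leaf (hadj x hx) (huniq x hx)
      have : Nontrivial ({x}ᶜ : Set V) := by
        rw [← Fintype.one_lt_card_iff_nontrivial, Fintype.card_compl_set]
        simp only [Fintype.card_unique]
        omega
      obtain ⟨⟨w, hw⟩, hsw⟩ := hT'.connected.preconnected.exists_adj_of_nontrivial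
        ⟨f x, (hadj x hx).ne'⟩
      have hsw' : T.Adj (f x) w := hsw
      obtain ⟨z, hz, hzx, hzw⟩ := h2 w hw hsw'
      simp only [Finset.coe_filter, Finset.mem_univ, true_and, Set.mem_ofPred_eq]
      rw [← card_neighborFinset_eq_degree]
      have hsub : ({x, w, z} : Finset V) ⊆ T.neighborFinset (f x) := by
        intro u hu
        simp only [Finset.mem_insert, Finset.mem_singleton] at hu
        rw [mem_neighborFinset]
        rcases hu with rfl | rfl | rfl
        exacts [(hadj _ hx).symm, hsw', hz]
      have h3 : ({x, w, z} : Finset V).card = 3 :=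
        Finset.card_eq_three.2 ⟨x, w, z, fun h => hw h.symm, hzx.symm, hzw.symm, rfl⟩
      exact h3 ▸ Finset.card_le_card hsub
    · by_contra hne
      obtain ⟨z, hz, hzs⟩ := (hcon x (f x) (hadj x hx) (huniq x hx)).1 y (Ne.symm hne)
        (hxy ▸ hadj y hy)
      exact hzs (hxy ▸ huniq y hy z hz)
  have hsum : ∑ v, T.degree v + (Finset.univ.filter (fun v => T.degree v = 1)).card ≥
      2 * Fintype.card V + (Finset.univ.filter (fun v => 3 ≤ T.degree v)).card := by
    have h2 : 2 * Fintype.card V = ∑ _v : V, 2 := by simp [mul_comm]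
    rw [Finset.card_filter, Finset.card_filter, h2, ← Finset.sum_add_distrib,
      ← Finset.sum_add_distrib]
    refine Finset.sum_le_sum fun v _ => ?_
    have := hpos v
    split_ifs <;> omega
  rw [sum_degrees_eq_twice_card_edges] at hsum
  have := hT.card_edgeFinset
  omega

/-! ### The lower bound -/

universe u

/-- The lower bound, together with the shape of the trees that attain it. Each step of the
induction gains the maximal matchings through one edge at a vertex `c`; unless the tree is starlike
at `c`, there are at least two of them and the bound is strict. -/
theorem IsTree.half_le_numMaximalMatchings_and (n : ℕ) :
    ∀ (V : Type u) [Fintype V] (T : SimpleGraph V), T.IsTree → Fintype.card V = n →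
      (n + 1) / 2 ≤ numMaximalMatchings T ∧
        (numMaximalMatchings T ≤ (n + 1) / 2 → ∃ c, T.IsStarlikeAt c) := by
  classical
  induction n using Nat.strong_induction_on with
  | _ n ih =>
  intro V _ T hT hn
  by_cases hn3 : n < 3
  · refine ⟨?_, fun _ => ?_⟩
    · have := numMaximalMatchings_pos T
      omega
    · obtain ⟨c⟩ := hT.connected.nonempty
      refine ⟨c, fun a b₁ b₂ hac hbc _ hab _ => ?_⟩
      have h3 : ({a, b₁, c} : Finset V).card = 3 :=
        Finset.card_eq_three.2 ⟨a, b₁, c, hab.ne, hac, hbc, rfl⟩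
      have := Finset.card_le_univ ({a, b₁, c} : Finset V)
      omega
  obtain ⟨x, s, hxs, hx, ⟨y, hyx, hys, hy⟩ | ⟨w, hwx, hsw, hs⟩⟩ :=
    hT.exists_twin_leaves_or_pendant_path (by omega)
  · have hT' := hT.induce_compl_leaf hxs hx
    have hcard : Fintype.card ({x}ᶜ : Set V) = n - 1 := by
      rw [Fintype.card_compl_set]
      simp [hn]
    have hih := (ih (n - 1) (by omega) _ _ hT' hcard).1
    have hadd := numMaximalMatchings_add_ncard_le_of_twin_leaves (Embedding.induce {x}ᶜ)
      Subtype.range_coe hyx hys hxs hy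
    refine ⟨?_, fun hle => ⟨s, fun a b₁ b₂ has h1s h2s h1 h2 => ?_⟩⟩
    · have := one_le_ncard_maximal_isMatching_adj hxs.symm
      omega
    · by_contra hne
      have hax : a ≠ x := fun h => h1s (hx b₁ (h ▸ h1))
      have hbx : ∀ b, T.Adj a b → b ≠ x := fun b hb h => has (hx a (h ▸ hb.symm))
      have := two_le_ncard_maximal_isMatching_adj hxs.symm h1 h2 hne has hax h1s (hbx _ h1)
        h2s (hbx _ h2)
      omega
  · have hT₁ := hT.induce_compl_leaf hxs hx
    have hsx : s ∈ ({x}ᶜ : Set V) := hxs.ne'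
    have hT₂ := hT₁.induce_compl_leaf (x := ⟨s, hsx⟩) (s := ⟨w, hwx⟩) hsw (by
      rintro ⟨z, hz⟩ hsz
      exact Subtype.ext ((hs z hsz).resolve_left hz))
    have hcard : Fintype.card ({⟨s, hsx⟩}ᶜ : Set ({x}ᶜ : Set V)) = n - 2 := by
      rw [Fintype.card_compl_set, Fintype.card_compl_set]
      simp only [Fintype.card_unique, hn]
      omega
    have hih := (ih (n - 2) (by omega) _ _ hT₂ hcard).1
    have hadd := numMaximalMatchings_add_ncard_le_of_edge (w := w)
      ((Embedding.induce {x}ᶜ).comp (Embedding.induce {⟨s, hsx⟩}ᶜ)) (by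
        ext v
        constructor
        · rintro ⟨⟨⟨z, hz⟩, hzs⟩, rfl⟩
          exact fun h => h.elim hz fun h => hzs (Subtype.ext h)
        · intro hv
          exact ⟨⟨⟨v, fun h => hv (Or.inl h)⟩, fun h => hv (Or.inr (congrArg Subtype.val h))⟩,
            rfl⟩) hxs.symm hwx
    refine ⟨?_, fun hle => ⟨w, fun a b₁ b₂ haw h1w h2w h1 h2 => ?_⟩⟩
    · have := one_le_ncard_maximal_isMatching_adj hsw.symm
      omega
    · by_contra hne
      -- The neighbours of `s` are `w` and `x`, so the path `b₁ - a - b₂` avoids `s`.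
      have has : a ≠ s := by
        rintro rfl
        exact hne (((hs _ h1).resolve_right h1w).trans ((hs _ h2).resolve_right h2w).symm)
      have hbs : ∀ b, T.Adj a b → b ≠ s := by
        rintro b hb rfl
        obtain rfl := (hs a hb.symm).resolve_right haw
        exact hne ((hx _ h1).trans (hx _ h2).symm)
      have := two_le_ncard_maximal_isMatching_adj hsw.symm h1 h2 hne haw has h1w (hbs _ h1)
        h2w (hbs _ h2)
      omega

/-! ### Maximal matchings of starlike graphs -/

/-- In a graph that is starlike at `c`, a maximal matching is determined by the partner of `c`:
the leg of `c` that is used loses its outer edge, and all other outer edges are present. -/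
theorem IsStarlikeAt.eq_of_adj_iff {c : V} (hc : G.IsStarlikeAt c) {M N : G.Subgraph}
    (hM : Maximal Subgraph.IsMatching M) (hN : Maximal Subgraph.IsMatching N)
    (h : ∀ z, M.Adj c z ↔ N.Adj c z) : M = N := by
  have key : ∀ M N : G.Subgraph, Maximal Subgraph.IsMatching M → Maximal Subgraph.IsMatching N →
      (∀ z, M.Adj c z ↔ N.Adj c z) → ∀ a b, M.Adj a b → N.Adj a b := by
    intro M N hM hN h a b hab
    by_cases hac : a = c
    · subst hac; exact (h b).1 hab
    by_cases hbc : b = c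
    · subst hbc; exact ((h a).1 hab.symm).symm
    have key' : ∀ a b, a ≠ c → b ≠ c → M.Adj a b → a ∈ N.verts → N.Adj a b := by
      intro a b hac hbc hab ha
      obtain ⟨p, hp, -⟩ := hN.prop ha
      have hpc : p ≠ c := by
        rintro rfl
        exact hbc (hM.prop.eq_of_adj_left hab ((h a).2 hp.symm).symm)
      rwa [hc a b p hac hbc hpc (M.adj_sub hab) (N.adj_sub hp)]
    rcases (maximal_isMatching_iff.1 hN).2 a b (M.adj_sub hab) with ha | hb
    · exact key' a b hac hbc hab ha
    · exact (key' b a hbc hac hab.symm hb).symm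
  exact hM.prop.ext_adj hN.prop fun u v =>
    ⟨key M N hM hN h u v, key N M hN hM (fun z => (h z).symm) u v⟩

theorem IsStarlikeAt.ncard_maximal_isMatching_mem_verts_le [Finite V] {c : V}
    (hc : G.IsStarlikeAt c) :
    {M : G.Subgraph | Maximal Subgraph.IsMatching M ∧ c ∈ M.verts}.ncard ≤
      (G.neighborSet c).ncard := by
  have hpartner : ∀ M : G.Subgraph, Maximal Subgraph.IsMatching M ∧ c ∈ M.verts →
      ∃ p, M.Adj c p := fun M hM => (hM.1.prop hM.2).exists
  have : Nonempty V := ⟨c⟩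
  choose! f hf using hpartner
  refine Set.ncard_le_ncard_of_injOn f (fun M hM => M.adj_sub (hf M hM)) ?_ (Set.toFinite _)
  intro M hM N hN hMN
  refine hc.eq_of_adj_iff hM.1 hN.1 fun z => ⟨fun h => ?_, fun h => ?_⟩
  · rw [hM.1.prop.eq_of_adj_left h (hf M hM), hMN]
    exact hf N hN
  · rw [hN.1.prop.eq_of_adj_left h (hf N hN), ← hMN]
    exact hf M hM

theorem IsStarlikeAt.numMaximalMatchings_le_add_one [Finite V] {c : V} (hc : G.IsStarlikeAt c) :
    numMaximalMatchings G ≤ (G.neighborSet c).ncard + 1 := by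
  have h1 : {M : G.Subgraph | Maximal Subgraph.IsMatching M ∧ c ∉ M.verts}.ncard ≤ 1 := by
    refine (Set.ncard_le_one (Set.toFinite _)).2 fun M hM N hN => ?_
    exact hc.eq_of_adj_iff hM.1 hN.1 fun z =>
      ⟨fun h => absurd (M.edge_vert h) hM.2, fun h => absurd (N.edge_vert h) hN.2⟩
  calc numMaximalMatchings G
      ≤ ({M : G.Subgraph | Maximal Subgraph.IsMatching M ∧ c ∈ M.verts} ∪
        {M : G.Subgraph | Maximal Subgraph.IsMatching M ∧ c ∉ M.verts}).ncard := by
        refine Set.ncard_le_ncard (fun M hM => ?_) (Set.toFinite _)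
        by_cases h : c ∈ M.verts
        exacts [Or.inl ⟨hM, h⟩, Or.inr ⟨hM, h⟩]
    _ ≤ _ := (Set.ncard_union_le _ _).trans
        (Nat.add_le_add hc.ncard_maximal_isMatching_mem_verts_le h1)

/-- If some leaf is adjacent to the centre, then every maximal matching covers the centre. -/
theorem IsStarlikeAt.numMaximalMatchings_le [Finite V] {c l : V} (hc : G.IsStarlikeAt c)
    (hlc : G.Adj l c) (hl : ∀ z, G.Adj l z → z = c) :
    numMaximalMatchings G ≤ (G.neighborSet c).ncard := by
  refine le_trans (Set.ncard_le_ncard (fun M (hM : Maximal _ M) => And.intro hM ?_)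
    (Set.toFinite _)) hc.ncard_maximal_isMatching_mem_verts_le
  rcases (maximal_isMatching_iff.1 hM).2 l c hlc with h | h
  · obtain ⟨z, hz, -⟩ := hM.prop h
    exact hl z (M.adj_sub hz) ▸ M.edge_vert hz.symm
  · exact h

/-! ### Subdivided stars -/

/-- The subdivided edges of `K_{1,m}` are indexed by the `i : Fin m` with `t ≤ i`. -/
noncomputable def starEdgesFromEquiv (t m : ℕ) : {i : Fin m // t ≤ (i : ℕ)} ≃ starEdgesFrom t m :=
  Equiv.ofBijective
    (fun i => ⟨⟨s(Sum.inl 0, Sum.inr i.1), by simp⟩, i.1, i.2, rfl⟩) <| by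
    constructor
    · intro i j hij
      simpa [Subtype.ext_iff] using hij
    · rintro ⟨⟨e, he⟩, i, hi, h⟩
      exact ⟨⟨i, hi⟩, Subtype.ext (Subtype.ext h.symm)⟩

theorem subdividedStar_adj_center_inr {t m : ℕ} (i : Fin m) :
    (subdividedStar t m).Adj (Sum.inl (Sum.inl 0)) (Sum.inl (Sum.inr i)) ↔ (i : ℕ) < t := by
  constructor
  · rintro ⟨e, he, h⟩
    by_contra! hi
    exact he ⟨i, hi, h⟩
  · intro hi
    refine ⟨⟨s(Sum.inl 0, Sum.inr i), by simp⟩, ?_, rfl⟩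
    rintro ⟨j, hj, h⟩
    have : i = j := by simpa using h
    omega

theorem subdividedStar_adj_center_mid {t m : ℕ} (i : {i : Fin m // t ≤ (i : ℕ)}) :
    (subdividedStar t m).Adj (Sum.inl (Sum.inl 0)) (Sum.inr (starEdgesFromEquiv t m i)) :=
  Sym2.mem_mk_left _ _

theorem subdividedStar_adj_inr_mid {t m : ℕ} (i : Fin m) (j : {i : Fin m // t ≤ (i : ℕ)}) :
    (subdividedStar t m).Adj (Sum.inl (Sum.inr i)) (Sum.inr (starEdgesFromEquiv t m j)) ↔
      i = j := by
  change Sum.inr i ∈ s(Sum.inl 0, Sum.inr j.1) ↔ _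
  simp

theorem not_subdividedStar_adj_inr_inr {t m : ℕ} (i j : Fin m) :
    ¬ (subdividedStar t m).Adj (Sum.inl (Sum.inr i)) (Sum.inl (Sum.inr j)) := by
  rintro ⟨⟨e, he⟩, -, h⟩
  have h' : e = s(Sum.inr i, Sum.inr j) := h
  subst h'
  simp at he

theorem not_subdividedStar_adj_mid_mid {t m : ℕ} (e f : starEdgesFrom t m) :
    ¬ (subdividedStar t m).Adj (Sum.inr e) (Sum.inr f) := id

theorem card_subdividedStar (t m : ℕ) :
    Nat.card ((Fin 1 ⊕ Fin m) ⊕ starEdgesFrom t m) = 1 + m + (m - t) := by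
  rw [Nat.card_sum, Nat.card_sum, ← Nat.card_congr (starEdgesFromEquiv t m)]
  have : Nat.card {i : Fin m // t ≤ (i : ℕ)} = m - t := by
    rw [Nat.card_eq_fintype_card, Fintype.card_subtype]
    have := Finset.card_filter_add_card_filter_not (s := (Finset.univ : Finset (Fin m)))
      (fun i => (i : ℕ) < t)
    simp [Fin.card_filter_val_lt] at this
    omega
  rw [this]
  simp

theorem subdividedStar_vertex_cases {t m : ℕ} (v : (Fin 1 ⊕ Fin m) ⊕ starEdgesFrom t m) :
    v = Sum.inl (Sum.inl 0) ∨ (∃ i, v = Sum.inl (Sum.inr i)) ∨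
      ∃ j, v = Sum.inr (starEdgesFromEquiv t m j) := by
  rcases v with (a | i) | e
  · exact Or.inl (by rw [Subsingleton.elim a 0])
  · exact Or.inr (Or.inl ⟨i, rfl⟩)
  · exact Or.inr (Or.inr ⟨(starEdgesFromEquiv t m).symm e, by simp⟩)

theorem subdividedStar_isStarlikeAt (t m : ℕ) :
    (subdividedStar t m).IsStarlikeAt (Sum.inl (Sum.inl 0)) := by
  intro a b₁ b₂ ha h₁ h₂ hab₁ hab₂
  obtain ⟨i, rfl⟩ | ⟨i, rfl⟩ := (subdividedStar_vertex_cases a).resolve_left ha <;>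
  obtain ⟨j, rfl⟩ | ⟨j, rfl⟩ := (subdividedStar_vertex_cases b₁).resolve_left h₁ <;>
  obtain ⟨k, rfl⟩ | ⟨k, rfl⟩ := (subdividedStar_vertex_cases b₂).resolve_left h₂
  · exact absurd hab₁ (not_subdividedStar_adj_inr_inr _ _)
  · exact absurd hab₁ (not_subdividedStar_adj_inr_inr _ _)
  · exact absurd hab₂ (not_subdividedStar_adj_inr_inr _ _)
  · rw [subdividedStar_adj_inr_mid] at hab₁ hab₂
    rw [Subtype.ext (hab₁.symm.trans hab₂)]
  · rw [adj_comm, subdividedStar_adj_inr_mid] at hab₁ hab₂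
    rw [hab₁, hab₂]
  · exact absurd hab₂ (not_subdividedStar_adj_mid_mid _ _)
  · exact absurd hab₁ (not_subdividedStar_adj_mid_mid _ _)
  · exact absurd hab₁ (not_subdividedStar_adj_mid_mid _ _)

theorem ncard_neighborSet_subdividedStar_le (t m : ℕ) :
    ((subdividedStar t m).neighborSet (Sum.inl (Sum.inl 0))).ncard ≤ m := by
  let f : Fin m → (Fin 1 ⊕ Fin m) ⊕ starEdgesFrom t m := fun i =>
    if h : t ≤ (i : ℕ) then Sum.inr (starEdgesFromEquiv t m ⟨i, h⟩) else Sum.inl (Sum.inr i)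
  have hsub : (subdividedStar t m).neighborSet (Sum.inl (Sum.inl 0)) ⊆ f '' Set.univ := by
    intro v hv
    rw [mem_neighborSet] at hv
    obtain rfl | ⟨i, rfl⟩ | ⟨⟨i, hi⟩, rfl⟩ := subdividedStar_vertex_cases v
    · exact absurd rfl hv.ne
    · rw [subdividedStar_adj_center_inr] at hv
      exact ⟨i, trivial, dif_neg (by omega)⟩
    · exact ⟨i, trivial, dif_pos hi⟩
  calc _ ≤ (f '' Set.univ).ncard := Set.ncard_le_ncard hsub (Set.toFinite _)
    _ ≤ (Set.univ : Set (Fin m)).ncard := Set.ncard_image_le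
    _ = m := by simp [Set.ncard_univ]

theorem numMaximalMatchings_subdividedStar_le_add_one (t m : ℕ) :
    numMaximalMatchings (subdividedStar t m) ≤ m + 1 :=
  (subdividedStar_isStarlikeAt t m).numMaximalMatchings_le_add_one.trans
    (Nat.add_le_add_right (ncard_neighborSet_subdividedStar_le t m) 1)

theorem numMaximalMatchings_subdividedStar_le {t m : ℕ} (ht : 0 < t) (htm : t ≤ m) :
    numMaximalMatchings (subdividedStar t m) ≤ m := by
  have hadj := (subdividedStar_adj_center_inr (t := t) (⟨0, by omega⟩ : Fin m)).2 ht
  refine ((subdividedStar_isStarlikeAt t m).numMaximalMatchings_le hadj.symm fun z hz => ?_).trans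
    (ncard_neighborSet_subdividedStar_le t m)
  obtain rfl | ⟨i, rfl⟩ | ⟨⟨i, hi⟩, rfl⟩ := subdividedStar_vertex_cases z
  · rfl
  · exact absurd hz (not_subdividedStar_adj_inr_inr _ _)
  · rw [subdividedStar_adj_inr_mid] at hz
    subst hz
    simp only at hi
    omega

/-- The vertices of a connected graph starlike at `c` are at distance at most two from `c`. -/
theorem IsStarlikeAt.eq_or_adj_or_exists_adj (hG : G.Connected) {c : V} (hc : G.IsStarlikeAt c)
    (v : V) : v = c ∨ G.Adj c v ∨ ∃ u, G.Adj c u ∧ G.Adj u v := by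
  obtain ⟨p⟩ := hG.preconnected v c
  induction p with
  | nil => exact Or.inl rfl
  | @cons x y c hxy p ih =>
    rcases ih hc with rfl | hy | ⟨u, hu, huy⟩
    · exact Or.inr (Or.inl hxy.symm)
    · exact Or.inr (Or.inr ⟨y, hy, hxy.symm⟩)
    · by_cases hxc : x = c
      · exact Or.inl hxc
      by_cases hyc : y = c
      · subst hyc
        exact Or.inr (Or.inl hxy.symm)
      · rw [hc y x u hyc hxc hu.ne' hxy.symm huy.symm]
        exact Or.inr (Or.inl hu)

/-- The neighbours of `c` can be numbered such that those of degree one come first. -/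
theorem exists_equiv_neighborSet_leaves_first [Finite V] (G : SimpleGraph V) (c : V) :
    ∃ t ≤ (G.neighborSet c).ncard, ∃ e : Fin (G.neighborSet c).ncard ≃ G.neighborSet c,
      ∀ i : Fin _, (i : ℕ) < t ↔ ∀ z, G.Adj (e i) z → z = c := by
  classical
  let e₀ : Fin (G.neighborSet c).ncard ≃ G.neighborSet c :=
    (Finite.equivFinOfCardEq (Nat.card_coe_set_eq _)).symm
  let q : Fin (G.neighborSet c).ncard → Prop := fun i => ∀ z, G.Adj (e₀ i) z → z = c
  have hle : Fintype.card {i // q i} ≤ (G.neighborSet c).ncard := by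
    simpa using Fintype.card_subtype_le q
  have hcard : Fintype.card {i : Fin (G.neighborSet c).ncard // (i : ℕ) < Fintype.card {i // q i}} =
      Fintype.card {i // q i} := by
    rw [Fintype.card_subtype, Fin.card_filter_val_lt]
    omega
  let σ := (Fintype.equivOfCardEq hcard).extendSubtype
  refine ⟨_, hle, σ.trans e₀, fun i => ⟨fun hi => ?_, fun hi => ?_⟩⟩
  · exact Equiv.extendSubtype_mem (Fintype.equivOfCardEq hcard) i hi
  · by_contra h
    exact Equiv.extendSubtype_not_mem (Fintype.equivOfCardEq hcard) i h hi

/-- A tree that is starlike at `c` is a subdivided star with `deg c` legs. Acyclicity is used only to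
exclude edges between neighbours of `c`. -/
theorem IsTree.exists_iso_subdividedStar [Finite V] {T : SimpleGraph V} (hT : T.IsTree) {c : V}
    (hc : T.IsStarlikeAt c) :
    ∃ t ≤ (T.neighborSet c).ncard, Nonempty (T ≃g subdividedStar t (T.neighborSet c).ncard) := by
  classical
  obtain ⟨t, htm, e, he⟩ := exists_equiv_neighborSet_leaves_first T c
  generalize (T.neighborSet c).ncard = m at *
  refine ⟨t, htm, ?_⟩
  have hadj : ∀ i, T.Adj c (e i) := fun i => (e i).2
  have htri : ∀ u v, T.Adj c u → T.Adj c v → ¬ T.Adj u v := by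
    intro u v hu hv huv
    refine hT.dist_ne_of_adj c huv ?_
    rw [dist_eq_one_iff_adj.2 hu, dist_eq_one_iff_adj.2 hv]
  have hinj : ∀ i j, (e i : V) = e j → i = j := fun i j h => e.injective (Subtype.ext h)
  have hpartner : ∀ i : Fin m, ¬ (i : ℕ) < t → ∃ p, T.Adj (e i) p ∧ p ≠ c := by
    intro i hi
    rw [he] at hi
    push Not at hi
    exact hi
  have : Nonempty V := ⟨c⟩
  choose! p hp hpc using hpartner
  have hpinj : ∀ i j : Fin m, ¬ (i : ℕ) < t → T.Adj (p i) (e j) → i = j := fun i j hi h =>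
    hinj i j (hc (p i) _ _ (hpc i hi) (hadj i).ne' (hadj j).ne' (hp i hi).symm h)
  have hpn : ∀ i : Fin m, ¬ (i : ℕ) < t → ¬ T.Adj c (p i) := fun i hi h =>
    htri _ _ (hadj i) h (hp i hi)
  -- The end of the leg `i` is `e i` if the leg has length one, and the partner of `e i` otherwise.
  let q : Fin m → V := fun i => if (i : ℕ) < t then e i else p i
  have hq1 : ∀ i : Fin m, (i : ℕ) < t → q i = e i := fun i hi => if_pos hi
  have hq2 : ∀ i : Fin m, ¬ (i : ℕ) < t → q i = p i := fun i hi => if_neg hi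
  have hcq : ∀ i : Fin m, T.Adj c (q i) ↔ (i : ℕ) < t := by
    intro i
    by_cases hi : (i : ℕ) < t
    · simp only [hq1 i hi, hi, hadj]
    · simp only [hq2 i hi, hi, hpn i hi]
  have hqe : ∀ i j : Fin m, ¬ (j : ℕ) < t → (T.Adj (q i) (e j) ↔ i = j) := by
    intro i j hj
    by_cases hi : (i : ℕ) < t
    · rw [hq1 i hi]
      exact ⟨fun h => absurd h (htri _ _ (hadj i) (hadj j)), fun h => absurd (h ▸ hi) hj⟩
    · rw [hq2 i hi]
      refine ⟨hpinj i j hi, ?_⟩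
      rintro rfl
      exact (hp i hi).symm
  have hqc : ∀ i, q i ≠ c := by
    intro i
    by_cases hi : (i : ℕ) < t
    · rw [hq1 i hi]; exact (hadj i).ne'
    · rw [hq2 i hi]; exact hpc i hi
  have hqq : ∀ i j, ¬ T.Adj (q i) (q j) := by
    have key : ∀ i j : Fin m, (i : ℕ) < t → ¬ T.Adj (q i) (q j) := by
      intro i j hi h
      rw [hq1 i hi] at h
      exact hqc j ((he i).1 hi _ h)
    intro i j h
    by_cases hi : (i : ℕ) < t
    · exact key i j hi h
    by_cases hj : (j : ℕ) < t
    · exact key j i hj h.symm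
    · rw [hq2 i hi, hq2 j hj] at h
      have := hc (p i) _ _ (hpc i hi) (hpc j hj) (hadj i).ne' h (hp i hi).symm
      exact hpn j hj (this ▸ hadj i)
  have hqinj : ∀ i j, q i = q j → i = j := by
    intro i j h
    have hij : (i : ℕ) < t ↔ (j : ℕ) < t := by rw [← hcq i, ← hcq j, h]
    by_cases hi : (i : ℕ) < t
    · rw [hq1 i hi, hq1 j (hij.1 hi)] at h
      exact hinj i j h
    · have hj := mt hij.2 hi
      exact (hqe i j hj).1 (h ▸ (hqe j j hj).2 rfl)
  have hqne : ∀ i j : Fin m, ¬ (j : ℕ) < t → q i ≠ e j := by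
    intro i j hj h
    have hi : (i : ℕ) < t := (hcq i).1 (h ▸ hadj j)
    rw [hq1 i hi] at h
    exact hj (hinj i j h ▸ hi)
  let g : (Fin 1 ⊕ Fin m) ⊕ starEdgesFrom t m → V :=
    Sum.elim (Sum.elim (fun _ => c) q) (fun x => e ((starEdgesFromEquiv t m).symm x).1)
  have hg0 : g (Sum.inl (Sum.inl 0)) = c := rfl
  have hg1 : ∀ i, g (Sum.inl (Sum.inr i)) = q i := fun i => rfl
  have hg2 : ∀ j, g (Sum.inr (starEdgesFromEquiv t m j)) = e j.1 := fun j => by simp [g]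
  have hginj : Function.Injective g := by
    intro x y hxy
    obtain rfl | ⟨i, rfl⟩ | ⟨⟨i, hi⟩, rfl⟩ := subdividedStar_vertex_cases x <;>
    obtain rfl | ⟨j, rfl⟩ | ⟨⟨j, hj⟩, rfl⟩ := subdividedStar_vertex_cases y <;>
    simp only [hg0, hg1, hg2] at hxy
    · rfl
    · exact absurd hxy.symm (hqc j)
    · exact absurd hxy (hadj j).ne
    · exact absurd hxy (hqc i)
    · rw [hqinj i j hxy]
    · exact absurd hxy (hqne i j hj.not_gt)
    · exact absurd hxy (hadj i).ne'
    · exact absurd hxy.symm (hqne j i hi.not_gt)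
    · obtain rfl := hinj i j hxy
      rfl
  have hgsurj : Function.Surjective g := by
    have hnbr : ∀ u, T.Adj c u → ∃ i, (e i : V) = u := fun u hu =>
      ⟨e.symm ⟨u, hu⟩, by simp⟩
    intro v
    rcases hc.eq_or_adj_or_exists_adj hT.connected v with rfl | hv | ⟨u, hu, huv⟩
    · exact ⟨_, hg0⟩
    · obtain ⟨i, rfl⟩ := hnbr v hv
      by_cases hi : (i : ℕ) < t
      · exact ⟨_, (hg1 i).trans (hq1 i hi)⟩
      · exact ⟨_, hg2 ⟨i, not_lt.1 hi⟩⟩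
    · by_cases hvc : v = c
      · exact ⟨_, hg0.trans hvc.symm⟩
      obtain ⟨i, rfl⟩ := hnbr u hu
      have hi : ¬ (i : ℕ) < t := fun hi => hvc ((he i).1 hi v huv)
      refine ⟨_, (hg1 i).trans ((hq2 i hi).trans ?_)⟩
      exact hc _ _ _ hu.ne' (hpc i hi) hvc (hp i hi) huv
  refine ⟨(RelIso.mk (Equiv.ofBijective g ⟨hginj, hgsurj⟩) ?_ : subdividedStar t m ≃g T).symm⟩
  intro x y
  change T.Adj (g x) (g y) ↔ _
  obtain rfl | ⟨i, rfl⟩ | ⟨⟨i, hi⟩, rfl⟩ := subdividedStar_vertex_cases x <;>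
  obtain rfl | ⟨j, rfl⟩ | ⟨⟨j, hj⟩, rfl⟩ := subdividedStar_vertex_cases y <;>
  simp only [hg0, hg1, hg2]
  · simp
  · rw [hcq, subdividedStar_adj_center_inr]
  · exact iff_of_true (hadj j) (subdividedStar_adj_center_mid ⟨j, hj⟩)
  · rw [adj_comm, hcq, adj_comm, subdividedStar_adj_center_inr]
  · exact iff_of_false (hqq i j) (not_subdividedStar_adj_inr_inr i j)
  · rw [hqe i j hj.not_gt, subdividedStar_adj_inr_mid]
  · exact iff_of_true (hadj i).symm (subdividedStar_adj_center_mid ⟨i, hi⟩).symm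
  · rw [adj_comm, hqe j i hi.not_gt, adj_comm, subdividedStar_adj_inr_mid]
  · exact iff_of_false (htri _ _ (hadj i) (hadj j)) (not_subdividedStar_adj_mid_mid _ _)

end SimpleGraph

/-! ### The bound and the extremal trees -/

theorem Nat.ceil_rat_half (n : ℕ) : ⌈(n : ℚ) / 2⌉₊ = (n + 1) / 2 := by
  obtain ⟨k, rfl | rfl⟩ := n.even_or_odd'
  · have : ((2 * k : ℕ) : ℚ) / 2 = (k : ℕ) := by push_cast; ring
    rw [this, Nat.ceil_natCast]
    omega
  · rw [show (2 * k + 1 + 1) / 2 = k + 1 by omega, Nat.ceil_eq_iff (by omega)]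
    constructor <;> push_cast <;> linarith

theorem mainTheorem1 {V : Type*} [Fintype V] (T : SimpleGraph V) (hT : T.IsTree)
    (n : ℕ) (hn : Fintype.card V = n) :
    ⌈(n : ℚ) / 2⌉₊ ≤ numMaximalMatchings T ∧
    (numMaximalMatchings T = ⌈(n : ℚ) / 2⌉₊ ↔
      (Odd n ∧ (Nonempty (T ≃g subdividedStar 0 ((n - 1) / 2)) ∨
        Nonempty (T ≃g subdividedStar 2 ((n + 1) / 2)))) ∨
      (Even n ∧ Nonempty (T ≃g subdividedStar 1 (n / 2)))) := by
  rw [Nat.ceil_rat_half]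
  obtain ⟨hle, hstar⟩ := hT.half_le_numMaximalMatchings_and n V T hn
  have hcard : ∀ t m, Nonempty (T ≃g subdividedStar t m) → n = 1 + m + (m - t) := by
    rintro t m ⟨e⟩
    rw [← SimpleGraph.card_subdividedStar t m, ← Nat.card_congr e.toEquiv,
      Nat.card_eq_fintype_card, hn]
  refine ⟨hle, fun heq => ?_, fun h => le_antisymm ?_ hle⟩
  · obtain ⟨c, hc⟩ := hstar heq.le
    obtain ⟨t, htm, hiso⟩ := hT.exists_iso_subdividedStar hc
    have hdeg := SimpleGraph.ncard_neighborSet_le_numMaximalMatchings T c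
    generalize (T.neighborSet c).ncard = m at htm hiso hdeg
    have hnm := hcard t m hiso
    -- `m ≤ Ψ(T) = ⌈n / 2⌉` with `n = 2 * m - t + 1` forces `t ≤ 2`.
    have ht : t ≤ 2 := by omega
    interval_cases t
    · refine Or.inl ⟨⟨m, by omega⟩, Or.inl ?_⟩
      rwa [show (n - 1) / 2 = m by omega]
    · refine Or.inr ⟨⟨m, by omega⟩, ?_⟩
      rwa [show n / 2 = m by omega]
    · refine Or.inl ⟨⟨m - 1, by omega⟩, Or.inr ?_⟩
      rwa [show (n + 1) / 2 = m by omega]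
  · rcases h with ⟨⟨k, hk⟩, hiso | hiso⟩ | ⟨⟨k, hk⟩, hiso⟩
    · have := SimpleGraph.numMaximalMatchings_subdividedStar_le_add_one 0 ((n - 1) / 2)
      rw [hiso.some.numMaximalMatchings_eq]
      omega
    · have := hcard _ _ hiso
      rw [hiso.some.numMaximalMatchings_eq]
      exact SimpleGraph.numMaximalMatchings_subdividedStar_le (by omega) (by omega)
    · have := hcard _ _ hiso
      have := SimpleGraph.numMaximalMatchings_subdividedStar_le (t := 1) (m := n / 2) (by omega)
        (by omega)
      rw [hiso.some.numMaximalMatchings_eq]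
      omega
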